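/- Let $\mathbb K=\mathbb R$ or $\mathbb C$, and let $\ell_p^n$ denote $\mathbb K^n$ with the $\ell_p$ norm, with canonical basis $e_1,\dots,e_n$; put $1/\infty=0$. A Banach space $F$ has cotype $q$ with constant $K$ if for all $n$ and all $x_1,\dots,x_n\in F$ $$\Big(\sum_{j=1}^n\|x_j\|^q\Big)^{1/q}\le K\Big(2^{-n}\sum_{\varepsilon\in\{-1,1\}^n}\Big\|\sum_{j=1}^n\varepsilon_jx_j\Big\|^2\Big)^{1/2}.$$ A bounded linear operator $v\colon E\to F$ is absolutely $(r,1)$-summing if there is $C\ge 0$ with $$\Big(\sum_{j=1}^n\|v(x_j)\|^r\Big)^{1/r}\le C\sup_{\varphi\in B_{E^*}}\sum_{j=1}^n|\varphi(x_j)|$$ for all $n$ and all $x_1,\dots,x_n\in E$; $\pi_{r,1}(v)$ is the infimum of all such $C$. **Proposition.** Let $m\ge 2$ be an integer and let $K$ be a real number. There is a constant $C>0$, depending only on $m$ and $K$, such that the following holds. Let $E,F$ be Banach spaces over $\mathbb K$, let $1\le r\le q<\infty$, suppose that $F$ has cotype $q$ with constant $K$, and let $v\colon E\to F$ be absolutely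 $(r,1)$-summing. Let $p_1,\dots,p_m\in[1,\infty]$ satisfy $$\frac1{p_1}+\cdots+\frac1{p_m}<\frac1r\qquad\text{and}\qquad\sum_{k\ne i}\frac1{p_k}\le\frac1r-\frac1q$$ for some $i\in\{1,\dots,m\}$, and define $\lambda_r>0$ by $\frac1{\lambda_r}=\frac1r-\big(\frac1{p_1}+\cdots+\frac1{p_m}\big)$. Then for every such $i$, every $n$ and every $m$-linear operator $A\colon\ell_{p_1}^n\times\cdots\times\ell_{p_m}^n\to E$, $$\Bigg(\sum_{j_i=1}^n\Big(\sum_{\widehat{j_i}}\|vA(e_{j_1},\dots,e_{j_m})\|_F^q\Big)^{\lambda_r/q}\Bigg)^{1/\lambda_r}\le C\,\|A\|\,\pi_{r,1}(v),$$ where $\sum_{\widehat{j_i}}$ is the sum over all indices $j_k\in\{1,\dots,n\}$ with $k\ne i$, and $\|A\|$ is the supremum of $\|A(z^{(1)},\dots,z^{(m)})\|$ over $\|z^{(k)}\|_{\ell_{p_k}^n}\le1$. -/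

import Mathlib

open scoped ENNReal

noncomputable section

/-- The Banach space `F` has cotype `q` with constant `K`: for all finite families of vectors,
`(∑ ‖x_j‖^q)^(1/q) ≤ K (𝔼 ‖∑ ε_j x_j‖²)^(1/2)`, the average being taken over the `2 ^ n` equally
likely choices of signs `ε_j = ±1`. A space has cotype `q` iff this holds for some `K`. -/
def HasCotypeWith (F : Type*) [NormedAddCommGroup F] (q K : ℝ) : Prop :=
  ∀ (n : ℕ) (x : Fin n → F),
    (∑ j, ‖x j‖ ^ q) ^ (1 / q) ≤
      K * Real.sqrt ((∑ ε : Fin n → ℤˣ, ‖∑ j, (ε j : ℤ) • x j‖ ^ 2) / 2 ^ n)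

section Summing

variable {𝕜 : Type*} [RCLike 𝕜]
  {E : Type*} [NormedAddCommGroup E] [NormedSpace 𝕜 E]
  {F : Type*} [NormedAddCommGroup F] [NormedSpace 𝕜 F]

/-- The weak `ℓ_s` norm of a finite family: the supremum of `(∑ |φ(x_j)|^s)^(1/s)` over the closed
unit ball of the topological dual of `E`. -/
def weakLpNorm (𝕜 : Type*) [RCLike 𝕜] {E : Type*} [NormedAddCommGroup E] [NormedSpace 𝕜 E]
    (s : ℝ) {n : ℕ} (x : Fin n → E) : ℝ :=
  ⨆ φ : Metric.closedBall (0 : StrongDual 𝕜 E) 1, (∑ j, ‖φ.1 (x j)‖ ^ s) ^ (1 / s)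

/-- `C ≥ 0` is an admissible constant in the definition of an absolutely `(r, s)`-summing
operator. -/
def IsSummingConst (r s : ℝ) (v : E →L[𝕜] F) (C : ℝ) : Prop :=
  0 ≤ C ∧ ∀ (n : ℕ) (x : Fin n → E),
    (∑ j, ‖v (x j)‖ ^ r) ^ (1 / r) ≤ C * weakLpNorm 𝕜 s x

/-- `v` is absolutely `(r, s)`-summing. -/
def IsAbsolutelySumming (r s : ℝ) (v : E →L[𝕜] F) : Prop :=
  ∃ C : ℝ, IsSummingConst r s v C

/-- The `(r, s)`-summing norm `π_{r,s}(v)`: the infimum of the admissible constants. -/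
def summingNorm (r s : ℝ) (v : E →L[𝕜] F) : ℝ :=
  sInf {C : ℝ | IsSummingConst r s v C}

end Summing

/-- `∑_{k ∈ S} 1 / p_k`, with `1 / ∞ = 0`. -/
def sumInv {m : ℕ} (p : Fin m → ℝ≥0∞) (S : Finset (Fin m)) : ℝ :=
  ∑ k ∈ S, ((p k)⁻¹).toReal

/-- The exponent `λ_r` given by `1 / λ_r = 1 / r - (1 / p_1 + ⋯ + 1 / p_m)`. -/
def lambdaExp {m : ℕ} (r : ℝ) (p : Fin m → ℝ≥0∞) : ℝ :=
  (1 / r - sumInv p Finset.univ)⁻¹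

/-- `ℓ_p^n`: the space `𝕜^n` with the `ℓ_p` norm. -/
abbrev EllP (𝕜 : Type*) [RCLike 𝕜] (p : ℝ≥0∞) (n : ℕ) : Type _ :=
  PiLp p (fun _ : Fin n => 𝕜)

end

/-! Weights are inserted and then removed. A point of the unit ball of `ℓ_{p_k}^n` is given moduli
`w k l ^ (1 / p_k)`, with `w k` a sub-probability vector, and its coordinates are multiplied by
random signs. Cotype, iterated over the `m` indices, bounds the `ℓ_q` norm of a slice `j i = t` of
the weighted coefficients by an average over signs; Minkowski and `(r,1)`-summability in coordinate
`i` then give an `ℓ_r(ℓ_q)` bound, uniform in the weights and valid in every coordinate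
(`sum_weighted_coeff_le`). First moments keep this averaging linear; `sum_signs_norm_sq_le` provides
them at the cost of `√2`.

Removing the weight of index `k` lowers the reciprocal outer exponent by `1 / p_k`. In coordinate
`k` the weight is constant on slices and duality (`sum_rpow_le_of_weighted`) suffices; the other
coordinates follow from `mixed_norm_exchange`, which needs outer exponent at most `q`. The
hypothesis on the sum over `k ≠ i` ensures this while those weights are removed (`remove_weights`).
The weight of `i` goes last, by duality alone, so `λ_r` may exceed `q`. -/

/-! ### Poincaré inequalities on the cube and Khinchine–Kahane -/

/-- The sum over all edges of the discrete cube (each counted twice) of the squared increments. -/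
def cubeEnergy {n : ℕ} (f : (Fin n → ℤˣ) → ℝ) : ℝ :=
  ∑ i, ∑ ε, (f ε - f (Function.update ε i (-ε i))) ^ 2

lemma sum_signs_succ {n : ℕ} (f : (Fin (n + 1) → ℤˣ) → ℝ) :
    ∑ ε, f ε = ∑ ε, f (Fin.cons 1 ε) + ∑ ε, f (Fin.cons (-1) ε) := by
  rw [← (Fin.consEquiv (fun _ : Fin (n + 1) => ℤˣ)).sum_comp f, Fintype.sum_prod_type,
    UnitsInt.univ, Finset.sum_pair (by decide)]
  rfl

lemma cubeEnergy_succ {n : ℕ} (f : (Fin (n + 1) → ℤˣ) → ℝ) :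
    cubeEnergy f = cubeEnergy (fun ε => f (Fin.cons 1 ε)) + cubeEnergy (fun ε => f (Fin.cons (-1) ε))
      + 2 * ∑ ε, (f (Fin.cons 1 ε) - f (Fin.cons (-1) ε)) ^ 2 := by
  unfold cubeEnergy
  rw [Fin.sum_univ_succ, sum_signs_succ]
  simp only [sum_signs_succ (fun ε => (f ε - f (Function.update ε (Fin.succ _) _)) ^ 2),
    Fin.cons_update, Fin.cons_succ, Fin.cons_zero, Fin.update_cons_zero, Finset.sum_add_distrib,
    neg_neg]
  have : ∑ ε, (f (Fin.cons (-1) ε) - f (Fin.cons 1 ε)) ^ 2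
      = ∑ ε, (f (Fin.cons 1 ε) - f (Fin.cons (-1) ε)) ^ 2 :=
    Finset.sum_congr rfl fun _ _ => by ring
  rw [this]
  ring

lemma card_signs (n : ℕ) : ((Finset.univ : Finset (Fin n → ℤˣ)).card : ℝ) = 2 ^ n := by
  simp [Finset.card_univ]

/-- Poincaré's inequality on the discrete cube. -/
lemma cube_poincare : ∀ {n : ℕ} (f : (Fin n → ℤˣ) → ℝ),
    4 * (∑ ε, f ε ^ 2 - (∑ ε, f ε) ^ 2 / 2 ^ n) ≤ cubeEnergy f
  | 0, f => by simp [cubeEnergy]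
  | n + 1, f => by
    have h1 := cube_poincare (fun ε => f (Fin.cons 1 ε))
    have h2 := cube_poincare (fun ε => f (Fin.cons (-1) ε))
    -- The difference of the means on the two half-cubes is controlled by the edges joining them.
    have h3 := sq_sum_le_card_mul_sum_sq (s := Finset.univ)
      (f := fun ε : Fin n → ℤˣ => f (Fin.cons 1 ε) - f (Fin.cons (-1) ε))
    rw [card_signs, Finset.sum_sub_distrib, ← div_le_iff₀' (by positivity)] at h3
    rw [cubeEnergy_succ, sum_signs_succ f, sum_signs_succ (fun ε => f ε ^ 2)]
    have : (∑ ε, f (Fin.cons 1 ε) + ∑ ε, f (Fin.cons (-1) ε)) ^ 2 / 2 ^ (n + 1)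
        = (∑ ε, f (Fin.cons 1 ε)) ^ 2 / 2 ^ n + (∑ ε, f (Fin.cons (-1) ε)) ^ 2 / 2 ^ n
          - (∑ ε, f (Fin.cons 1 ε) - ∑ ε, f (Fin.cons (-1) ε)) ^ 2 / 2 ^ n / 2 := by
      field_simp
      ring
    rw [this]
    linarith

lemma cubeEnergy_comp_neg {n : ℕ} (f : (Fin n → ℤˣ) → ℝ) :
    cubeEnergy (fun ε => f (-ε)) = cubeEnergy f := by
  unfold cubeEnergy
  refine Finset.sum_congr rfl fun i _ => ?_
  rw [← Equiv.sum_comp (Equiv.neg (Fin n → ℤˣ)) (fun ε => (f ε - f (Function.update ε i (-ε i))) ^ 2)]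
  refine Finset.sum_congr rfl fun ε _ => ?_
  have : -Function.update ε i (-ε i) = Function.update (-ε) i (- (-ε) i) := by
    ext k; by_cases h : k = i
    · subst h; simp
    · simp [h]
  simp [this]

lemma cubeEnergy_parallelogram {n : ℕ} (f g : (Fin n → ℤˣ) → ℝ) :
    cubeEnergy (fun ε => f ε + g ε) + cubeEnergy (fun ε => f ε - g ε)
      = 2 * cubeEnergy f + 2 * cubeEnergy g := by
  unfold cubeEnergy
  simp only [Finset.mul_sum, ← Finset.sum_add_distrib]
  exact Finset.sum_congr rfl fun _ _ => Finset.sum_congr rfl fun _ _ => by ring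

/-- Poincaré's inequality for even functions on the cube, with the improved constant. -/
lemma cube_poincare_even : ∀ {n : ℕ} (f : (Fin n → ℤˣ) → ℝ), (∀ ε, f (-ε) = f ε) →
    8 * (∑ ε, f ε ^ 2 - (∑ ε, f ε) ^ 2 / 2 ^ n) ≤ cubeEnergy f
  | 0, f, _ => by simp [cubeEnergy]
  | n + 1, f, hf => by
    -- Evenness makes `f` a copy of `g` on one half-cube and of its reflection on the other. The
    -- even part `a` of `g` has constant 8 by induction; the odd part `b` has only 4, and the
    -- joining edges, of energy `8 * ∑ b ^ 2`, make up the deficit.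
    set g : (Fin n → ℤˣ) → ℝ := fun ε => f (Fin.cons 1 ε) with hg
    have hneg : ∀ ε : Fin n → ℤˣ, f (Fin.cons (-1) ε) = g (-ε) := fun ε => by
      rw [hg, ← hf (Fin.cons (-1) ε)]
      congr 1
      ext k
      refine Fin.cases ?_ (fun k => ?_) k <;> simp
    set a : (Fin n → ℤˣ) → ℝ := fun ε => (g ε + g (-ε)) / 2 with ha
    set b : (Fin n → ℤˣ) → ℝ := fun ε => (g ε - g (-ε)) / 2 with hb
    have sneg : ∀ h : (Fin n → ℤˣ) → ℝ, ∑ ε, h (-ε) = ∑ ε, h ε := fun h =>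
      Equiv.sum_comp (Equiv.neg (Fin n → ℤˣ)) h
    have h1 := cube_poincare_even a (fun ε => by simp [ha, add_comm])
    have h2 := cube_poincare b
    have sb : ∑ ε, b ε = 0 := by
      simp only [hb, ← Finset.sum_div, Finset.sum_sub_distrib, sneg g, sub_self, zero_div]
    have sa : ∑ ε, a ε = ∑ ε, g ε := by
      simp only [ha, ← Finset.sum_div, Finset.sum_add_distrib, sneg g]; ring
    have ea : (fun ε => a ε + b ε) = g := by ext ε; simp only [ha, hb]; ring
    have eb : (fun ε => a ε - b ε) = fun ε => g (-ε) := by ext ε; simp only [ha, hb]; ring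
    have h3 := cubeEnergy_parallelogram a b
    rw [ea, eb, cubeEnergy_comp_neg] at h3
    have h4 : ∑ ε, g ε ^ 2 = ∑ ε, a ε ^ 2 + ∑ ε, b ε ^ 2 := by
      have h5 : ∑ ε, (a ε ^ 2 + b ε ^ 2) = ∑ ε, (g ε ^ 2 + g (-ε) ^ 2) / 2 :=
        Finset.sum_congr rfl fun ε _ => by simp only [ha, hb]; ring
      rw [← Finset.sum_add_distrib, h5, ← Finset.sum_div, Finset.sum_add_distrib,
        sneg (fun ε => g ε ^ 2)]
      ring
    have h6 : ∑ ε, (g ε - g (-ε)) ^ 2 = 4 * ∑ ε, b ε ^ 2 := by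
      rw [Finset.mul_sum]; exact Finset.sum_congr rfl fun ε _ => by simp only [hb]; ring
    rw [cubeEnergy_succ, sum_signs_succ f, sum_signs_succ (fun ε => f ε ^ 2)]
    simp only [hneg]
    simp only [← hg] at *
    change 8 * (∑ ε, g ε ^ 2 + ∑ ε, g (-ε) ^ 2 - (∑ ε, g ε + ∑ ε, g (-ε)) ^ 2 / 2 ^ (n + 1))
      ≤ cubeEnergy g + cubeEnergy (fun ε => g (-ε)) + 2 * ∑ ε, (g ε - g (-ε)) ^ 2
    rw [cubeEnergy_comp_neg, sneg g, sneg (fun ε => g ε ^ 2), h6]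
    rw [sa] at h1
    rw [sb] at h2
    have : (∑ ε, g ε + ∑ ε, g ε) ^ 2 / 2 ^ (n + 1) = 2 * ((∑ ε, g ε) ^ 2 / 2 ^ n) := by
      field_simp; ring
    rw [this, h4]
    norm_num at h2
    linarith

/-- The Khinchine–Kahane inequality between the first and the second moment, with the optimal
constant of Latała and Oleszkiewicz. -/
lemma sum_signs_norm_sq_le {F : Type*} [NormedAddCommGroup F] {n : ℕ} (x : Fin n → F)
    [NormedSpace ℝ F] :
    ∑ ε : Fin n → ℤˣ, ‖∑ j, (ε j : ℤ) • x j‖ ^ 2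
      ≤ 2 * (∑ ε : Fin n → ℤˣ, ‖∑ j, (ε j : ℤ) • x j‖) ^ 2 / 2 ^ n := by
  set X : (Fin n → ℤˣ) → F := fun ε => ∑ j, (ε j : ℤ) • x j with hX
  have hflip : ∀ ε i, X (Function.update ε i (-ε i)) = X ε - (2 : ℤ) • (ε i : ℤ) • x i := by
    intro ε i
    have : X ε - X (Function.update ε i (-ε i)) = (2 : ℤ) • (ε i : ℤ) • x i := by
      simp only [hX]
      rw [← Finset.sum_sub_distrib, Finset.sum_eq_single i]
      · simp [two_smul]
      · intro j _ hj; simp [hj]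
      · simp
    rw [← this, sub_sub_cancel]
  -- Flipping sign `i` subtracts twice the `i`-th term, so the `n` flipped sums add up to `(n - 2) X
  -- ε`.
  have hsum : ∀ ε, ((n : ℝ) - 2) * ‖X ε‖ ≤ ∑ i, ‖X (Function.update ε i (-ε i))‖ := by
    intro ε
    have h1 : ∑ i, X (Function.update ε i (-ε i)) = ((n : ℝ) - 2) • X ε := by
      simp only [hflip, Finset.sum_sub_distrib, ← Finset.smul_sum]
      rw [sub_smul, Finset.sum_const, Finset.card_univ, Fintype.card_fin, Nat.cast_smul_eq_nsmul]
      congr 1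
      rw [two_smul, two_smul]
    calc ((n : ℝ) - 2) * ‖X ε‖ ≤ |(n : ℝ) - 2| * ‖X ε‖ := by gcongr; exact le_abs_self _
      _ = ‖∑ i, X (Function.update ε i (-ε i))‖ := by rw [h1, norm_smul, Real.norm_eq_abs]
      _ ≤ _ := norm_sum_le _ _
  have hP := cube_poincare_even (fun ε => ‖X ε‖) (fun ε => by
    have : X (-ε) = - X ε := by simp [hX]
    rw [this, norm_neg])
  have hE : cubeEnergy (fun ε => ‖X ε‖)
      = 2 * ∑ ε, ‖X ε‖ * (n * ‖X ε‖ - ∑ i, ‖X (Function.update ε i (-ε i))‖) := by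
    have h1 : ∀ i, ∑ ε, (‖X ε‖ - ‖X (Function.update ε i (-ε i))‖) ^ 2
        = ∑ ε, 2 * (‖X ε‖ * (‖X ε‖ - ‖X (Function.update ε i (-ε i))‖)) := by
      intro i
      have hinv : Function.Involutive
          (fun ε : Fin n → ℤˣ => Function.update ε i (-ε i)) := fun ε => by simp
      have h2 := Equiv.sum_comp (hinv.toPerm _) (fun ε => ‖X ε‖ ^ 2)
      change ∑ ε, ‖X (Function.update ε i (-ε i))‖ ^ 2 = _ at h2
      have h3 : ∑ ε, (‖X (Function.update ε i (-ε i))‖ ^ 2 - ‖X ε‖ ^ 2) = 0 := by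
        rw [Finset.sum_sub_distrib, h2, sub_self]
      rw [← sub_eq_zero, ← h3, ← Finset.sum_sub_distrib]
      exact Finset.sum_congr rfl fun ε _ => by ring
    unfold cubeEnergy
    rw [Finset.sum_congr rfl fun i _ => h1 i, Finset.sum_comm, Finset.mul_sum]
    refine Finset.sum_congr rfl fun ε _ => ?_
    rw [← Finset.mul_sum, ← Finset.mul_sum, Finset.sum_sub_distrib]
    simp
  -- Against the constant 8 of `hP`, the 4 here lets half of the second moment be absorbed.
  have hE2 : cubeEnergy (fun ε => ‖X ε‖) ≤ 4 * ∑ ε, ‖X ε‖ ^ 2 := by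
    rw [hE, Finset.mul_sum, Finset.mul_sum]
    refine Finset.sum_le_sum fun ε _ => ?_
    nlinarith [hsum ε, norm_nonneg (X ε)]
  have := hP.trans hE2
  rw [mul_div_assoc]
  linarith

/-! ### Hölder, weighted duality and mixed norms -/

lemma sum_rpow_mul_rpow_le {ι : Type*} (s : Finset ι) {f g : ι → ℝ} (hf : ∀ i, 0 ≤ f i)
    (hg : ∀ i, 0 ≤ g i) {θ : ℝ} (h0 : 0 < θ) (h1 : θ < 1) :
    ∑ i ∈ s, f i ^ θ * g i ^ (1 - θ) ≤ (∑ i ∈ s, f i) ^ θ * (∑ i ∈ s, g i) ^ (1 - θ) := by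
  have h1' : 0 < 1 - θ := by linarith
  have hpq : (1 / θ).HolderConjugate (1 / (1 - θ)) := by
    rw [Real.holderConjugate_iff]
    refine ⟨by rw [lt_div_iff₀ h0]; linarith, by simp⟩
  have := Real.inner_le_Lp_mul_Lq_of_nonneg s hpq (f := fun i => f i ^ θ)
    (g := fun i => g i ^ (1 - θ)) (fun i _ => Real.rpow_nonneg (hf i) _)
    (fun i _ => Real.rpow_nonneg (hg i) _)
  have e1 : ∀ i, (f i ^ θ) ^ (1 / θ) = f i := fun i => by
    rw [← Real.rpow_mul (hf i), mul_one_div_cancel h0.ne', Real.rpow_one]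
  have e2 : ∀ i, (g i ^ (1 - θ)) ^ (1 / (1 - θ)) = g i := fun i => by
    rw [← Real.rpow_mul (hg i), mul_one_div_cancel h1'.ne', Real.rpow_one]
  simpa only [e1, e2, one_div_one_div] using this

/-- Duality for weighted `ℓ_ρ` norms: the supremum of `‖w ^ s β‖_ρ` over all sub-probability
weights `w` is `‖β‖_λ` where `1 / λ = 1 / ρ - s`. -/
lemma sum_rpow_le_of_weighted {ι : Type*} [Fintype ι] {β : ι → ℝ} (hβ : ∀ t, 0 ≤ β t)
    {ρ l s B : ℝ} (hρ : 0 < ρ) (hl : 0 < l) (hs : s = 1 / ρ - 1 / l) (hB : 0 ≤ B)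
    (h : ∀ w : ι → ℝ, (∀ t, 0 ≤ w t) → ∑ t, w t ≤ 1 → ∑ t, (w t ^ s * β t) ^ ρ ≤ B ^ ρ) :
    ∑ t, β t ^ l ≤ B ^ l := by
  set T := ∑ t, β t ^ l with hT
  have hT0 : 0 ≤ T := Finset.sum_nonneg fun t _ => Real.rpow_nonneg (hβ t) _
  rcases hT0.eq_or_lt with h0 | hTpos
  · rw [← h0]; positivity
  -- The extremal weight of the duality.
  have h1 := h (fun t => β t ^ l / T) (fun t => div_nonneg (Real.rpow_nonneg (hβ t) _) hT0)
    (by rw [← Finset.sum_div, ← hT, div_self hTpos.ne'])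
  have hls : (l * s + 1) * ρ = l := by rw [hs]; field_simp; ring
  have e : ∀ t, ((β t ^ l / T) ^ s * β t) ^ ρ = β t ^ l / T ^ (s * ρ) := by
    intro t
    rcases (hβ t).eq_or_lt with hb | hb
    · rw [← hb, mul_zero, Real.zero_rpow hρ.ne', Real.zero_rpow hl.ne', zero_div]
    · rw [Real.div_rpow (Real.rpow_nonneg (hβ t) _) hT0, ← Real.rpow_mul (hβ t), div_mul_eq_mul_div,
        ← Real.rpow_add_one hb.ne', Real.div_rpow (Real.rpow_nonneg (hβ t) _)
        (Real.rpow_nonneg hT0 _), ← Real.rpow_mul (hβ t), ← Real.rpow_mul hT0, hls]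
  simp only [e] at h1
  rw [← Finset.sum_div, ← hT] at h1
  have e2 : T / T ^ (s * ρ) = T ^ (ρ / l) := by
    nth_rw 1 [← Real.rpow_one T]
    rw [← Real.rpow_sub hTpos]
    congr 1
    rw [hs]; field_simp; ring
  rw [e2] at h1
  have h2 := Real.rpow_le_rpow (Real.rpow_nonneg hT0 _) h1 (z := l / ρ) (by positivity)
  rwa [← Real.rpow_mul hT0, ← Real.rpow_mul hB, div_mul_div_cancel₀ hl.ne', div_self hρ.ne',
    Real.rpow_one, mul_div_cancel₀ _ hρ.ne'] at h2

/-- Exchange of the order of mixed norms: a weighted `ℓ_ρ(ℓ_q)` estimate by rows together with an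
`ℓ_λ(ℓ_q)` estimate by columns gives the `ℓ_λ(ℓ_q)` estimate by rows. The entries `y` are the
`q`-th powers of those of the matrix. -/
lemma mixed_norm_exchange {ι κ : Type*} [Fintype ι] [Fintype κ] {y : ι → κ → ℝ}
    (hy : ∀ t u, 0 ≤ y t u) {ρ l q s B : ℝ} (hρ : 0 < ρ) (hρl : ρ ≤ l) (hlq : l ≤ q)
    (hs : s = 1 / ρ - 1 / l) (hB : 0 ≤ B)
    (hrow : ∀ w : κ → ℝ, (∀ u, 0 ≤ w u) → ∑ u, w u ≤ 1 →
      ∑ t, (∑ u, (w u ^ s) ^ q * y t u) ^ (ρ / q) ≤ B ^ ρ)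
    (hcol : ∑ u, (∑ t, y t u) ^ (l / q) ≤ B ^ l) :
    ∑ t, (∑ u, y t u) ^ (l / q) ≤ B ^ l := by
  have hl : 0 < l := hρ.trans_le hρl
  have hq : 0 < q := hl.trans_le hlq
  rcases hlq.eq_or_lt with rfl | hlq
  · simp only [div_self hl.ne', Real.rpow_one] at hcol ⊢
    rwa [Finset.sum_comm]
  rcases hρl.eq_or_lt with rfl | hρl
  -- Here `s = 0`, and `0 ^ 0 = 1` turns the zero weight into no weight.
  · have := hrow 0 (fun _ => le_rfl) (by simp)
    simpa [hs] using this
  set R : ι → ℝ := fun t => ∑ u, y t u with hR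
  have hR0 : ∀ t, 0 ≤ R t := fun t => Finset.sum_nonneg fun u _ => hy t u
  have hRy : ∀ t u, R t = 0 → y t u = 0 := fun t u h =>
    (Finset.sum_eq_zero_iff_of_nonneg fun u _ => hy t u).1 h u (Finset.mem_univ u)
  set U : κ → ℝ := fun u => ∑ t, y t u * R t ^ (ρ / q - 1) with hU
  set V : κ → ℝ := fun u => ∑ t, y t u with hV
  have hU0 : ∀ u, 0 ≤ U u := fun u => Finset.sum_nonneg fun t _ =>
    mul_nonneg (hy t u) (Real.rpow_nonneg (hR0 t) _)
  have hV0 : ∀ u, 0 ≤ V u := fun u => Finset.sum_nonneg fun t _ => hy t u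
  -- The power `R t ^ (ρ / q - 1)` is the one that cancels after Hölder within row `t`, so duality
  -- applies to `U` for all weights at once.
  have hUsum : ∑ u, U u ^ (l / ρ) ≤ B ^ l := by
    have := sum_rpow_le_of_weighted (β := fun u => U u ^ (1 / ρ))
      (fun u => Real.rpow_nonneg (hU0 u) _) hρ hl hs hB ?_
    · simpa only [← Real.rpow_mul (hU0 _), one_div_mul_eq_div] using this
    intro w hw0 hw1
    refine le_trans ?_ (hrow w hw0 hw1)
    have e : ∀ u, (w u ^ s * U u ^ (1 / ρ)) ^ ρ
        = ∑ t, R t ^ (ρ / q - 1) * ((w u ^ s) ^ ρ * y t u) := by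
      intro u
      rw [Real.mul_rpow (Real.rpow_nonneg (hw0 u) _) (Real.rpow_nonneg (hU0 u) _),
        ← Real.rpow_mul (hU0 u), one_div_mul_cancel hρ.ne', Real.rpow_one, hU, Finset.mul_sum]
      exact Finset.sum_congr rfl fun t _ => by ring
    rw [Finset.sum_congr rfl fun u _ => e u, Finset.sum_comm]
    refine Finset.sum_le_sum fun t _ => ?_
    rw [← Finset.mul_sum]
    rcases (hR0 t).eq_or_lt with h0 | hpos
    · simp only [hRy t _ h0.symm, mul_zero, Finset.sum_const_zero]
      positivity
    have hθ : ρ / q < 1 := by rw [div_lt_one hq]; linarith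
    have h1 := sum_rpow_mul_rpow_le Finset.univ (f := fun u => (w u ^ s) ^ q * y t u)
      (g := fun u => y t u) (fun u => mul_nonneg (Real.rpow_nonneg (Real.rpow_nonneg (hw0 u) _) _)
        (hy t u)) (hy t) (div_pos hρ hq) hθ
    have e3 : ∀ u, ((w u ^ s) ^ q * y t u) ^ (ρ / q) * y t u ^ (1 - ρ / q)
        = (w u ^ s) ^ ρ * y t u := by
      intro u
      have hws := Real.rpow_nonneg (hw0 u) s
      rw [Real.mul_rpow (Real.rpow_nonneg hws _) (hy t u), ← Real.rpow_mul hws,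
        mul_div_cancel₀ _ hq.ne', mul_assoc,
        ← Real.rpow_add_of_nonneg (hy t u) (by positivity) (by linarith)]
      simp
    simp only [e3] at h1
    calc R t ^ (ρ / q - 1) * ∑ u, (w u ^ s) ^ ρ * y t u
        ≤ R t ^ (ρ / q - 1) * ((∑ u, (w u ^ s) ^ q * y t u) ^ (ρ / q) * R t ^ (1 - ρ / q)) := by
          gcongr
      _ = (∑ u, (w u ^ s) ^ q * y t u) ^ (ρ / q) * (R t ^ (ρ / q - 1) * R t ^ (1 - ρ / q)) := by
          ring
      _ = _ := by rw [← Real.rpow_add hpos]; simp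
  have hqρ : 0 < q - ρ := by linarith
  -- `x` solves `(ρ / q - 1) * x = l / q - 1`; the outer Hölder exponent `α` below satisfies `(l /
  -- ρ) * α = x` and `(l / q) * (1 - α) = 1 - x`.
  set x : ℝ := (q - l) / (q - ρ) with hx
  have hx0 : 0 < x := div_pos (by linarith) hqρ
  have hx1 : x < 1 := by rw [hx, div_lt_one hqρ]; linarith
  have hx' : 1 - x = (l - ρ) / (q - ρ) := by rw [hx]; field_simp; ring
  set α : ℝ := ρ * x / l with hα
  have hα0 : 0 < α := by positivity
  have hα' : 1 - α = (1 - x) * q / l := by rw [hx', hα, hx]; field_simp; ring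
  have hα1 : α < 1 := by
    have : 0 < (1 - x) * q / l := div_pos (mul_pos (by linarith) hq) hl
    linarith
  have hexp : (ρ / q - 1) * x = l / q - 1 := by rw [hx]; field_simp; ring
  calc ∑ t, R t ^ (l / q) = ∑ u, ∑ t, y t u * R t ^ (l / q - 1) := by
        rw [Finset.sum_comm]
        refine Finset.sum_congr rfl fun t _ => ?_
        rw [← Finset.sum_mul]
        change _ = R t * _
        rcases (hR0 t).eq_or_lt with h0 | hpos
        · rw [← h0, zero_mul, Real.zero_rpow (by positivity)]
        · rw [mul_comm, ← Real.rpow_add_one hpos.ne', sub_add_cancel]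
    _ ≤ ∑ u, U u ^ x * V u ^ (1 - x) := by
        refine Finset.sum_le_sum fun u _ => ?_
        refine le_trans (le_of_eq ?_) (sum_rpow_mul_rpow_le Finset.univ
          (f := fun t => y t u * R t ^ (ρ / q - 1)) (g := fun t => y t u)
          (fun t => mul_nonneg (hy t u) (Real.rpow_nonneg (hR0 t) _)) (fun t => hy t u) hx0 hx1)
        refine Finset.sum_congr rfl fun t _ => ?_
        rw [Real.mul_rpow (hy t u) (Real.rpow_nonneg (hR0 t) _), ← Real.rpow_mul (hR0 t), hexp,
          mul_right_comm, ← Real.rpow_add_of_nonneg (hy t u) hx0.le (by linarith)]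
        simp
    _ = ∑ u, (U u ^ (l / ρ)) ^ α * (V u ^ (l / q)) ^ (1 - α) := by
        refine Finset.sum_congr rfl fun u _ => ?_
        rw [← Real.rpow_mul (hU0 u), ← Real.rpow_mul (hV0 u), hα', hα]
        congr 2 <;> field_simp
    _ ≤ (∑ u, U u ^ (l / ρ)) ^ α * (∑ u, V u ^ (l / q)) ^ (1 - α) :=
        sum_rpow_mul_rpow_le _ (fun u => Real.rpow_nonneg (hU0 u) _)
          (fun u => Real.rpow_nonneg (hV0 u) _) hα0 hα1
    _ ≤ (B ^ l) ^ α * (B ^ l) ^ (1 - α) := by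
        have : 0 ≤ 1 - α := by linarith
        have h1 : 0 ≤ ∑ u, U u ^ (l / ρ) := Finset.sum_nonneg fun u _ => Real.rpow_nonneg (hU0 u) _
        have h2 : 0 ≤ ∑ u, V u ^ (l / q) := Finset.sum_nonneg fun u _ => Real.rpow_nonneg (hV0 u) _
        gcongr
    _ = B ^ l := by
        rw [← Real.rpow_add_of_nonneg (by positivity) hα0.le (by linarith)]
        simp

/-! ### Cotype and multiple Rademacher sums -/

lemma rpow_sum_const_mul {ι : Type*} (s : Finset ι) {f : ι → ℝ} (hf : ∀ i, 0 ≤ f i) {c q : ℝ}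
    (hc : 0 ≤ c) (hq : 0 < q) :
    (∑ i ∈ s, (c * f i) ^ q) ^ (1 / q) = c * (∑ i ∈ s, f i ^ q) ^ (1 / q) := by
  have h : ∀ i, (c * f i) ^ q = c ^ q * f i ^ q := fun i => Real.mul_rpow hc (hf i)
  simp only [h]
  rw [← Finset.mul_sum, Real.mul_rpow (by positivity)
    (Finset.sum_nonneg fun i _ => Real.rpow_nonneg (hf i) _), ← Real.rpow_mul hc,
    mul_one_div_cancel hq.ne', Real.rpow_one]

lemma Lp_sum_le_of_nonneg {ι κ : Type*} (s : Finset ι) (u : Finset κ) {g : ι → κ → ℝ}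
    (hg : ∀ e j, 0 ≤ g e j) {q : ℝ} (hq : 1 ≤ q) :
    (∑ j ∈ u, (∑ e ∈ s, g e j) ^ q) ^ (1 / q) ≤ ∑ e ∈ s, (∑ j ∈ u, g e j ^ q) ^ (1 / q) := by
  classical
  have hq0 : 0 < q := by linarith
  induction s using Finset.induction_on with
  | empty => simp [Real.zero_rpow hq0.ne', Real.zero_rpow (inv_ne_zero hq0.ne')]
  | insert a s ha ih =>
    simp only [Finset.sum_insert ha]
    refine (Real.Lp_add_le_of_nonneg u hq (fun j _ => hg a j)
      (fun j _ => Finset.sum_nonneg fun e _ => hg e j)).trans ?_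
    gcongr

section Cotype

variable {F : Type*} [NormedAddCommGroup F]

/-- Cotype in terms of the first moments of Rademacher sums. -/
lemma HasCotypeWith.first_moment [NormedSpace ℝ F] {q K : ℝ} (h : HasCotypeWith F q K) {n : ℕ}
    (x : Fin n → F) :
    (∑ j, ‖x j‖ ^ q) ^ (1 / q) ≤
      (√2 * (|K| + 1) / 2 ^ n) * ∑ ε : Fin n → ℤˣ, ‖∑ j, (ε j : ℤ) • x j‖ := by
  set S := ∑ ε : Fin n → ℤˣ, ‖∑ j, (ε j : ℤ) • x j‖ with hS
  have hS0 : 0 ≤ S := Finset.sum_nonneg fun _ _ => norm_nonneg _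
  have h2 : √((∑ ε : Fin n → ℤˣ, ‖∑ j, (ε j : ℤ) • x j‖ ^ 2) / 2 ^ n) ≤ √2 * (S / 2 ^ n) := by
    rw [← Real.sqrt_sq (div_nonneg hS0 (by positivity : (0 : ℝ) ≤ 2 ^ n)),
      ← Real.sqrt_mul (by norm_num)]
    apply Real.sqrt_le_sqrt
    rw [div_le_iff₀ (by positivity)]
    refine (sum_signs_norm_sq_le x).trans (le_of_eq ?_)
    rw [← hS]
    field_simp
  calc _ ≤ _ := h n x
    _ ≤ (|K| + 1) * √((∑ ε : Fin n → ℤˣ, ‖∑ j, (ε j : ℤ) • x j‖ ^ 2) / 2 ^ n) := by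
      gcongr; linarith [le_abs_self K]
    _ ≤ (|K| + 1) * (√2 * (S / 2 ^ n)) := by gcongr
    _ = _ := by ring

/-- An estimate of `ℓ_q` norms by Rademacher sums passes to multiple Rademacher sums. -/
lemma multiple_cotype {q D : ℝ} (hq : 1 ≤ q) (hD : 0 ≤ D) {n : ℕ}
    (h : ∀ x : Fin n → F,
      (∑ j, ‖x j‖ ^ q) ^ (1 / q) ≤ D * ∑ ε : Fin n → ℤˣ, ‖∑ j, (ε j : ℤ) • x j‖) :
    ∀ (d : ℕ) (x : (Fin d → Fin n) → F), (∑ j, ‖x j‖ ^ q) ^ (1 / q) ≤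
      D ^ d * ∑ ε : Fin d → Fin n → ℤˣ, ‖∑ j, (∏ k, (ε k (j k) : ℤ)) • x j‖
  | 0, x => by
    have hq0 : q ≠ 0 := by linarith
    simp [← Real.rpow_mul (norm_nonneg _), mul_inv_cancel₀ hq0]
  | d + 1, x => by
    have hq0 : 0 < q := by linarith
    set g : (Fin n → ℤˣ) → (Fin d → Fin n) → F := fun ε j => ∑ a, (ε a : ℤ) • x (Fin.cons a j)
      with hg
    have e1 : ∑ j, ‖x j‖ ^ q = ∑ j, ∑ a, ‖x (Fin.cons a j)‖ ^ q := by
      rw [← Equiv.sum_comp (Fin.consEquiv (fun _ : Fin (d + 1) => Fin n)), Fintype.sum_prod_type,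
        Finset.sum_comm]
      rfl
    have e2 : ∀ (ε : Fin n → ℤˣ) (ε' : Fin d → Fin n → ℤˣ),
        ∑ j : Fin (d + 1) → Fin n,
          (∏ k, ((Fin.cons ε ε' : Fin (d + 1) → Fin n → ℤˣ) k (j k) : ℤ)) • x j
        = ∑ j, (∏ k, (ε' k (j k) : ℤ)) • g ε j := by
      intro ε ε'
      rw [← Equiv.sum_comp (Fin.consEquiv (fun _ : Fin (d + 1) => Fin n)), Fintype.sum_prod_type,
        Finset.sum_comm]
      refine Finset.sum_congr rfl fun j _ => ?_
      rw [hg, Finset.smul_sum]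
      refine Finset.sum_congr rfl fun a _ => ?_
      simp [Fin.consEquiv, Fin.prod_univ_succ, smul_smul, mul_comm]
    have h1 : ∀ j, ∑ a, ‖x (Fin.cons a j)‖ ^ q ≤ (D * ∑ ε, ‖g ε j‖) ^ q := by
      intro j
      have h2 := Real.rpow_le_rpow (by positivity) (h fun a => x (Fin.cons a j)) hq0.le
      rwa [← Real.rpow_mul (by positivity), one_div_mul_cancel hq0.ne', Real.rpow_one] at h2
    calc (∑ j, ‖x j‖ ^ q) ^ (1 / q)
        ≤ (∑ j, (D * ∑ ε, ‖g ε j‖) ^ q) ^ (1 / q) := by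
          rw [e1]
          gcongr with j
          exact h1 j
      _ = D * (∑ j, (∑ ε, ‖g ε j‖) ^ q) ^ (1 / q) :=
          rpow_sum_const_mul _ (fun j => by positivity) hD hq0
      -- Minkowski applies directly because the Rademacher bound is a first moment.
      _ ≤ D * ∑ ε, (∑ j, ‖g ε j‖ ^ q) ^ (1 / q) := by
          gcongr
          exact Lp_sum_le_of_nonneg _ _ (fun _ _ => norm_nonneg _) hq
      _ ≤ D * ∑ ε, (D ^ d * ∑ ε' : Fin d → Fin n → ℤˣ,
            ‖∑ j, (∏ k, (ε' k (j k) : ℤ)) • g ε j‖) := by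
          gcongr with ε
          exact multiple_cotype hq hD h d _
      _ = _ := by
          rw [← Equiv.sum_comp (Fin.consEquiv (fun _ : Fin (d + 1) => Fin n → ℤˣ)),
            Fintype.sum_prod_type, ← Finset.mul_sum, pow_succ', mul_assoc]
          simp only [← e2]
          rfl

end Cotype

/-! ### Summing operators and multilinear maps -/

section Summing

variable {𝕜 : Type*} [RCLike 𝕜] {E : Type*} [NormedAddCommGroup E] [NormedSpace 𝕜 E]
  {F : Type*} [NormedAddCommGroup F] [NormedSpace 𝕜 F]

lemma weakLpNorm_nonneg (s : ℝ) {n : ℕ} (x : Fin n → E) : 0 ≤ weakLpNorm 𝕜 s x :=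
  Real.iSup_nonneg fun _ => by positivity

lemma summingNorm_nonneg (r s : ℝ) (v : E →L[𝕜] F) : 0 ≤ summingNorm r s v :=
  Real.sInf_nonneg fun _ h => h.1

lemma IsAbsolutelySumming.le_summingNorm {r s : ℝ} {v : E →L[𝕜] F}
    (h : IsAbsolutelySumming r s v) {n : ℕ} (x : Fin n → E) :
    (∑ j, ‖v (x j)‖ ^ r) ^ (1 / r) ≤ summingNorm r s v * weakLpNorm 𝕜 s x := by
  rcases (weakLpNorm_nonneg (𝕜 := 𝕜) s x).eq_or_lt with h0 | hpos
  · obtain ⟨C, hC⟩ := h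
    have := hC.2 n x
    rwa [← h0, mul_zero] at this ⊢
  · rw [← div_le_iff₀ hpos]
    exact le_csInf h fun C hC => (div_le_iff₀ hpos).2 (hC.2 n x)

lemma PiLp_norm_le_of_forall_norm_le {p : ℝ≥0∞} [Fact (1 ≤ p)] {n : ℕ} {x y : EllP 𝕜 p n}
    (h : ∀ l, ‖x l‖ ≤ ‖y l‖) : ‖x‖ ≤ ‖y‖ := by
  rcases eq_or_ne p ∞ with rfl | hp
  · rw [PiLp.norm_eq_ciSup, PiLp.norm_eq_ciSup]
    exact Real.iSup_le (fun l => (h l).trans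
      (le_ciSup (f := fun l => ‖y l‖) (Set.finite_range _).bddAbove l))
      (Real.iSup_nonneg fun _ => norm_nonneg _)
  · have hp0 : 0 < p.toReal :=
      ENNReal.toReal_pos (zero_lt_one.trans_le Fact.out).ne' hp
    rw [PiLp.norm_eq_sum hp0, PiLp.norm_eq_sum hp0]
    gcongr with l
    exact h l

variable {m n : ℕ} {p : Fin m → ℝ≥0∞}

/-- Keeping only entry `t` of `z i` keeps exactly the coefficients with `j i = t`, so summability in
coordinate `i` sees slices. -/
lemma map_update_single_eq_sum
    (A : ContinuousMultilinearMap 𝕜 (fun k : Fin m => EllP 𝕜 (p k) n) E)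
    (z : ∀ k, EllP 𝕜 (p k) n) (i : Fin m) (t : Fin n) :
    A (Function.update z i (PiLp.single (p i) t (z i t)))
      = ∑ j : Fin m → Fin n, if j i = t then
          (∏ k, z k (j k)) • A (fun k => PiLp.single (p k) (j k) (1 : 𝕜)) else 0 := by
  have h1 : Function.update z i (PiLp.single (p i) t (z i t)) = fun k =>
      ∑ l, (if k = i ∧ l ≠ t then (0 : 𝕜) else z k l) • PiLp.single (p k) l (1 : 𝕜) := by
    funext k
    ext l
    by_cases hk : k = i
    · subst hk
      by_cases hl : l = t
      · subst hl; simp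
      · simp [hl]
    · simp [Finset.sum_apply, Pi.single_apply, hk]
  rw [h1, A.map_sum]
  refine Finset.sum_congr rfl fun j _ => ?_
  rw [A.map_smul_univ]
  split_ifs with hj
  · congr 1
    refine Finset.prod_congr rfl fun k _ => if_neg ?_
    rintro ⟨rfl, h⟩
    exact h hj
  · have h0 : ∏ k, (if k = i ∧ j k ≠ t then (0 : 𝕜) else z k (j k)) = 0 :=
      Finset.prod_eq_zero (Finset.mem_univ i) (if_pos ⟨rfl, hj⟩)
    rw [h0, zero_smul]

variable [∀ k, Fact (1 ≤ p k)]

/-- The summing inequality along one coordinate of a multilinear map. -/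
lemma IsAbsolutelySumming.sum_update_le {r : ℝ} {v : E →L[𝕜] F} (h : IsAbsolutelySumming r 1 v)
    (A : ContinuousMultilinearMap 𝕜 (fun k : Fin m => EllP 𝕜 (p k) n) E)
    (z : ∀ k, EllP 𝕜 (p k) n) (hz : ∀ k, ‖z k‖ ≤ 1) (i : Fin m) :
    (∑ t, ‖v (A (Function.update z i (PiLp.single (p i) t (z i t))))‖ ^ r) ^ (1 / r)
      ≤ ‖A‖ * summingNorm r 1 v := by
  refine (h.le_summingNorm _).trans ?_
  rw [mul_comm]
  gcongr
  · exact summingNorm_nonneg _ _ _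
  refine ciSup_le fun φ => ?_
  simp only [Real.rpow_one, div_one]
  set y : Fin n → E := fun t => A (Function.update z i (PiLp.single (p i) t (z i t))) with hy
  choose θ hθ hθ' using fun t => RCLike.exists_norm_eq_mul_self (φ.1 (y t))
  -- The phases `θ` align all values of `φ`; since they are unimodular, `w` stays in the unit ball
  -- and multilinearity collapses the sum to one value.
  set w : EllP 𝕜 (p i) n := ∑ t, θ t • PiLp.single (p i) t (z i t) with hw
  have hwl : ∀ l, w l = θ l * z i l := by
    intro l
    simp [hw, Finset.sum_apply, Pi.single_apply]
  have hwn : ‖w‖ ≤ 1 :=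
    (PiLp_norm_le_of_forall_norm_le fun l => by rw [hwl, norm_mul, hθ, one_mul]).trans (hz i)
  have hsum : ((∑ t, ‖φ.1 (y t)‖ : ℝ) : 𝕜) = φ.1 (A (Function.update z i w)) := by
    have h1 := A.toMultilinearMap.map_update_sum Finset.univ i
      (fun t => θ t • PiLp.single (p i) t (z i t)) z
    simp only [ContinuousMultilinearMap.coe_coe] at h1
    rw [hw, h1, map_sum]
    push_cast
    refine Finset.sum_congr rfl fun t _ => ?_
    rw [A.map_update_smul, map_smul, smul_eq_mul]
    exact hθ' t
  have hnn : 0 ≤ ∑ t, ‖φ.1 (y t)‖ := Finset.sum_nonneg fun _ _ => norm_nonneg _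
  calc ∑ t, ‖φ.1 (y t)‖ = ‖φ.1 (A (Function.update z i w))‖ := by
        rw [← hsum, RCLike.norm_of_nonneg hnn]
    _ ≤ ‖φ.1‖ * ‖A (Function.update z i w)‖ := φ.1.le_opNorm _
    _ ≤ 1 * ‖A‖ := by
        have h1 : ‖φ.1‖ ≤ 1 := mem_closedBall_zero_iff.1 φ.2
        have h2 : ‖A (Function.update z i w)‖ ≤ ‖A‖ := by
          refine (A.le_opNorm _).trans (mul_le_of_le_one_right (norm_nonneg _) ?_)
          refine Finset.prod_le_one (fun _ _ => norm_nonneg _) fun k _ => ?_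
          by_cases hk : k = i
          · subst hk; simpa using hwn
          · simpa [hk] using hz k
        gcongr
    _ = ‖A‖ := one_mul _

/-- The inequality for weighted coefficients, with outer exponent `r`. -/
lemma sum_weighted_coeff_le {q r K : ℝ} (hr : 1 ≤ r) (hrq : r ≤ q) (hF : HasCotypeWith F q K)
    {v : E →L[𝕜] F} (hv : IsAbsolutelySumming r 1 v)
    (A : ContinuousMultilinearMap 𝕜 (fun k : Fin m => EllP 𝕜 (p k) n) E)
    (a : ∀ k, EllP 𝕜 (p k) n) (ha : ∀ k, ‖a k‖ ≤ 1) (i : Fin m) :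
    ∑ t, (∑ j ∈ Finset.univ.filter (fun j : Fin m → Fin n => j i = t),
        ((∏ k, ‖a k (j k)‖) * ‖v (A fun k => PiLp.single (p k) (j k) (1 : 𝕜))‖) ^ q) ^ (r / q)
      ≤ ((√2 * (|K| + 1)) ^ m * ‖A‖ * summingNorm r 1 v) ^ r := by
  let _ : NormedSpace ℝ F := NormedSpace.restrictScalars ℝ 𝕜 F
  have hr0 : 0 < r := by linarith
  have hq0 : 0 < q := by linarith
  set D : ℝ := √2 * (|K| + 1) / 2 ^ n with hD
  have hD0 : 0 ≤ D := by positivity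
  set z : (Fin m → Fin n → ℤˣ) → ∀ k, EllP 𝕜 (p k) n := fun ε k =>
    WithLp.toLp (p k) fun l => ((ε k l : ℤ) : 𝕜) * a k l with hz
  have hsign : ∀ u : ℤˣ, ‖((u : ℤ) : 𝕜)‖ = 1 := fun u => by
    rcases Int.units_eq_one_or u with rfl | rfl <;> simp
  have hz1 : ∀ ε k, ‖z ε k‖ ≤ 1 := fun ε k =>
    (PiLp_norm_le_of_forall_norm_le fun l => by simp [hz, hsign]).trans (ha k)
  set Y : (Fin m → Fin n → ℤˣ) → Fin n → F := fun ε t =>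
    v (A (Function.update (z ε) i (PiLp.single (p i) t (z ε i t)))) with hY
  set x : Fin n → (Fin m → Fin n) → F := fun t j => if j i = t then
    (∏ k, a k (j k)) • v (A fun k => PiLp.single (p k) (j k) (1 : 𝕜)) else 0 with hx
  have hYx : ∀ ε t, Y ε t = ∑ j, (∏ k, (ε k (j k) : ℤ)) • x t j := by
    intro ε t
    simp only [hY, map_update_single_eq_sum, map_sum]
    refine Finset.sum_congr rfl fun j _ => ?_
    simp only [hx]
    split_ifs with hj
    · rw [map_smul, ← Int.cast_smul_eq_zsmul 𝕜, smul_smul]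
      congr 1
      simp [hz, Finset.prod_mul_distrib]
    · simp
  have hin : ∀ t, (∑ j ∈ Finset.univ.filter (fun j : Fin m → Fin n => j i = t),
      ((∏ k, ‖a k (j k)‖) * ‖v (A fun k => PiLp.single (p k) (j k) (1 : 𝕜))‖) ^ q)
      = ∑ j, ‖x t j‖ ^ q := by
    intro t
    rw [Finset.sum_filter]
    refine Finset.sum_congr rfl fun j _ => ?_
    simp only [hx]
    split_ifs with hj
    · rw [norm_smul, norm_prod]
    · rw [norm_zero, Real.zero_rpow hq0.ne']
  have hcot : ∀ t, (∑ j, ‖x t j‖ ^ q) ^ (1 / q) ≤ D ^ m * ∑ ε, ‖Y ε t‖ := by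
    intro t
    simp only [hYx]
    exact multiple_cotype (hr.trans hrq) hD0 hF.first_moment m (x t)
  have hmain : (∑ t, ((∑ j, ‖x t j‖ ^ q) ^ (1 / q)) ^ r) ^ (1 / r)
      ≤ (√2 * (|K| + 1)) ^ m * ‖A‖ * summingNorm r 1 v := by
    calc _ ≤ (∑ t, (D ^ m * ∑ ε, ‖Y ε t‖) ^ r) ^ (1 / r) := by
          gcongr with t; exact hcot t
      _ = D ^ m * (∑ t, (∑ ε, ‖Y ε t‖) ^ r) ^ (1 / r) :=
          rpow_sum_const_mul _ (fun t => by positivity) (by positivity) hr0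
      _ ≤ D ^ m * ∑ ε, (∑ t, ‖Y ε t‖ ^ r) ^ (1 / r) := by
          gcongr
          exact Lp_sum_le_of_nonneg _ _ (fun _ _ => norm_nonneg _) hr
      _ ≤ D ^ m * ∑ ε : Fin m → Fin n → ℤˣ, ‖A‖ * summingNorm r 1 v := by
          gcongr with ε
          exact hv.sum_update_le A (z ε) (hz1 ε) i
      _ = _ := by
          -- The `(2 ^ n) ^ m` sign patterns cancel the denominator of `D ^ m`.
          rw [Finset.sum_const, Finset.card_univ, nsmul_eq_mul, hD, div_pow]
          simp only [Fintype.card_pi, Fintype.card_units_int, Finset.prod_const, Finset.card_univ,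
            Fintype.card_fin]
          push_cast
          field_simp
  have h2 := Real.rpow_le_rpow (by positivity) hmain hr0.le
  rw [← Real.rpow_mul (by positivity), one_div_mul_cancel hr0.ne', Real.rpow_one] at h2
  refine le_trans (le_of_eq (Finset.sum_congr rfl fun t _ => ?_)) h2
  rw [hin, ← Real.rpow_mul (by positivity), one_div_mul_eq_div]

end Summing

/-! ### Removal of the weights -/

/-- From weighted `ℓ_r(ℓ_q)` estimates along all coordinates to unweighted estimates: the weights
indexed by `S` are removed at the price of the larger outer exponent. -/
lemma remove_weights {m n : ℕ} {c : (Fin m → Fin n) → ℝ} (hc : ∀ j, 0 ≤ c j) {s : Fin m → ℝ}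
    (hs : ∀ k, 0 ≤ s k) {r q B : ℝ} (hr : 0 < r) (hrq : r ≤ q) (hB : 0 ≤ B)
    (h : ∀ w : Fin m → Fin n → ℝ, (∀ k l, 0 ≤ w k l) → (∀ k, ∑ l, w k l ≤ 1) → ∀ i,
      ∑ t, (∑ j ∈ Finset.univ.filter (fun j : Fin m → Fin n => j i = t),
        ((∏ k, w k (j k) ^ s k) * c j) ^ q) ^ (r / q) ≤ B ^ r) (S : Finset (Fin m)) :
    1 / q ≤ 1 / r - ∑ k ∈ S, s k →
    ∀ w : Fin m → Fin n → ℝ, (∀ k l, 0 ≤ w k l) → (∀ k, ∑ l, w k l ≤ 1) → ∀ i,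
      ∑ t, (∑ j ∈ Finset.univ.filter (fun j : Fin m → Fin n => j i = t),
        ((∏ k ∈ Sᶜ, w k (j k) ^ s k) * c j) ^ q) ^ ((1 / r - ∑ k ∈ S, s k)⁻¹ / q)
        ≤ B ^ (1 / r - ∑ k ∈ S, s k)⁻¹ := by
  have hq : 0 < q := hr.trans_le hrq
  induction S using Finset.induction_on with
  | empty =>
    intro _ w hw0 hw1 i
    simpa using h w hw0 hw1 i
  | insert k₀ S hk₀ ih =>
    intro hS w hw0 hw1 i
    rw [Finset.sum_insert hk₀] at hS ⊢
    set σ := 1 / r - ∑ k ∈ S, s k with hσ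
    have hσ' : 1 / r - (s k₀ + ∑ k ∈ S, s k) = σ - s k₀ := by rw [hσ]; ring
    rw [hσ'] at hS ⊢
    have hq1 : 0 < 1 / q := by positivity
    have hs0 := hs k₀
    have hl : 0 < σ - s k₀ := hq1.trans_le hS
    have hρ : 0 < σ := by linarith
    specialize ih (by linarith)
    set G : (Fin m → Fin n) → ℝ := fun j => (∏ k ∈ (insert k₀ S)ᶜ, w k (j k) ^ s k) * c j with hG
    have hG0 : ∀ j, 0 ≤ G j := fun j => mul_nonneg
      (Finset.prod_nonneg fun k _ => Real.rpow_nonneg (hw0 _ _) _) (hc j)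
    -- Only the weight of `k₀` is left free; the other remaining weights are absorbed in `G`.
    have key : ∀ u : Fin n → ℝ, (∀ l, 0 ≤ u l) → ∑ l, u l ≤ 1 → ∀ i,
        ∑ t, (∑ j ∈ Finset.univ.filter (fun j : Fin m → Fin n => j i = t),
          (u (j k₀) ^ s k₀) ^ q * G j ^ q) ^ (σ⁻¹ / q) ≤ B ^ σ⁻¹ := by
      intro u hu0 hu1 i
      have := ih (Function.update w k₀ u)
        (fun k l => by by_cases hk : k = k₀
                       · subst hk; simpa using hu0 l
                       · simpa [hk] using hw0 k l)
        (fun k => by by_cases hk : k = k₀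
                     · subst hk; simpa using hu1
                     · simpa [hk] using hw1 k) i
      refine le_trans (le_of_eq ?_) this
      refine Finset.sum_congr rfl fun t _ => ?_
      congr 1
      refine Finset.sum_congr rfl fun j _ => ?_
      rw [← Real.mul_rpow (Real.rpow_nonneg (hu0 _) _) (hG0 j), hG, ← mul_assoc]
      congr 2
      have hcompl : Sᶜ = insert k₀ (insert k₀ S)ᶜ := by
        ext k
        by_cases hk : k = k₀
        · subst hk; simp [hk₀]
        · simp [hk]
      rw [hcompl, Finset.prod_insert (by simp), Function.update_self]
      congr 1
      refine Finset.prod_congr rfl fun k hk => ?_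
      have : k ≠ k₀ := by rintro rfl; simp at hk
      rw [Function.update_of_ne this]
    have hsl : s k₀ = 1 / σ⁻¹ - 1 / (σ - s k₀)⁻¹ := by simp
    have hcol : ∑ t, (∑ j ∈ Finset.univ.filter (fun j : Fin m → Fin n => j k₀ = t),
        G j ^ q) ^ ((σ - s k₀)⁻¹ / q) ≤ B ^ (σ - s k₀)⁻¹ := by
      have hsum0 : ∀ t, 0 ≤ ∑ j ∈ Finset.univ.filter (fun j : Fin m → Fin n => j k₀ = t), G j ^ q :=
        fun t => Finset.sum_nonneg fun j _ => Real.rpow_nonneg (hG0 j) _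
      have := sum_rpow_le_of_weighted (β := fun t =>
        (∑ j ∈ Finset.univ.filter (fun j : Fin m → Fin n => j k₀ = t), G j ^ q) ^ (1 / q))
        (fun t => Real.rpow_nonneg (hsum0 t) _) (inv_pos.2 hρ) (inv_pos.2 hl) hsl hB ?_
      · simpa only [← Real.rpow_mul (hsum0 _), one_div_mul_eq_div] using this
      intro u hu0 hu1
      refine le_trans (le_of_eq (Finset.sum_congr rfl fun t _ => ?_)) (key u hu0 hu1 k₀)
      have hu := Real.rpow_nonneg (hu0 t) (s k₀)
      have e : ∑ j ∈ Finset.univ.filter (fun j : Fin m → Fin n => j k₀ = t),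
          (u (j k₀) ^ s k₀) ^ q * G j ^ q
          = (u t ^ s k₀) ^ q *
            ∑ j ∈ Finset.univ.filter (fun j : Fin m → Fin n => j k₀ = t), G j ^ q := by
        rw [Finset.mul_sum]
        refine Finset.sum_congr rfl fun j hj => ?_
        rw [(Finset.mem_filter.1 hj).2]
      rw [e, Real.mul_rpow hu (Real.rpow_nonneg (hsum0 t) _),
        Real.mul_rpow (Real.rpow_nonneg hu _) (hsum0 t), ← Real.rpow_mul hu,
        ← Real.rpow_mul (hsum0 t), mul_div_cancel₀ _ hq.ne', one_div_mul_eq_div]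
    by_cases hi : i = k₀
    · subst hi; exact hcol
    -- The `q`-th powers are grouped by the pair `(j i, j k₀)`: the weight acts on columns, whose
    -- unweighted bound is `hcol`.
    set y : Fin n → Fin n → ℝ := fun t u =>
      ∑ j ∈ Finset.univ.filter (fun j : Fin m → Fin n => j i = t ∧ j k₀ = u), G j ^ q with hy
    have hrowsum : ∀ (f : Fin n → ℝ) t, ∑ u, f u * y t u
        = ∑ j ∈ Finset.univ.filter (fun j : Fin m → Fin n => j i = t), f (j k₀) * G j ^ q := by
      intro f t
      rw [← Finset.sum_fiberwise (Finset.univ.filter (fun j : Fin m → Fin n => j i = t))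
        (fun j => j k₀)]
      refine Finset.sum_congr rfl fun u _ => ?_
      rw [hy, Finset.mul_sum, Finset.filter_filter]
      refine Finset.sum_congr rfl fun j hj => ?_
      rw [(Finset.mem_filter.1 hj).2.2]
    have hcolsum : ∀ u, ∑ t, y t u
        = ∑ j ∈ Finset.univ.filter (fun j : Fin m → Fin n => j k₀ = u), G j ^ q := by
      intro u
      rw [← Finset.sum_fiberwise (Finset.univ.filter (fun j : Fin m → Fin n => j k₀ = u))
        (fun j => j i)]
      refine Finset.sum_congr rfl fun t _ => ?_
      rw [hy, Finset.filter_filter]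
      simp only [and_comm]
    have hrowsum1 := hrowsum 1
    simp only [Pi.one_apply, one_mul] at hrowsum1
    have := mixed_norm_exchange (y := y) (q := q) (fun t u => Finset.sum_nonneg fun j _ =>
      Real.rpow_nonneg (hG0 j) _) (inv_pos.2 hρ)
      ((inv_le_inv₀ hρ hl).2 (by linarith)) (by
        rw [inv_le_comm₀ hl hq, ← one_div]; exact hS) hsl hB
      (fun u hu0 hu1 => by
        simp only [hrowsum (fun l => (u l ^ s k₀) ^ q)]
        exact key u hu0 hu1 i)
      (by simpa only [hcolsum] using hcol)
    simpa only [hrowsum1] using this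

/-- For `p = ∞` the exponent is `0`, so all entries are `1` whatever the weight. -/
lemma norm_toLp_rpow_le_one {𝕜 : Type*} [RCLike 𝕜] {p : ℝ≥0∞} [Fact (1 ≤ p)] {n : ℕ}
    {w : Fin n → ℝ} (h0 : ∀ l, 0 ≤ w l) (h1 : ∑ l, w l ≤ 1) :
    ‖(WithLp.toLp p fun l => ((w l ^ (p⁻¹).toReal : ℝ) : 𝕜) : EllP 𝕜 p n)‖ ≤ 1 := by
  rcases eq_or_ne p ∞ with rfl | hp
  · rw [PiLp.norm_eq_ciSup]
    exact Real.iSup_le (fun l => by simp) zero_le_one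
  · have hp0 : 0 < p.toReal :=
      ENNReal.toReal_pos (zero_lt_one.trans_le Fact.out).ne' hp
    rw [PiLp.norm_eq_sum hp0]
    refine Real.rpow_le_one (by positivity) (le_trans (le_of_eq ?_) h1) (by positivity)
    refine Finset.sum_congr rfl fun l _ => ?_
    rw [RCLike.norm_ofReal, abs_of_nonneg (Real.rpow_nonneg (h0 l) _), ← Real.rpow_mul (h0 l),
      ENNReal.toReal_inv, inv_mul_cancel₀ hp0.ne', Real.rpow_one]

theorem mainTheorem7 (m : ℕ) (hm : 2 ≤ m) (K : ℝ) :
    ∃ C : ℝ, 0 < C ∧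
      ∀ (𝕜 : Type*) [RCLike 𝕜]
        (E : Type*) [NormedAddCommGroup E] [NormedSpace 𝕜 E] [CompleteSpace E]
        (F : Type*) [NormedAddCommGroup F] [NormedSpace 𝕜 F] [CompleteSpace F]
        (q r : ℝ) (_ : 1 ≤ r) (_ : r ≤ q) (_ : HasCotypeWith F q K)
        (v : E →L[𝕜] F) (_ : IsAbsolutelySumming r 1 v)
        (p : Fin m → ℝ≥0∞) [∀ k, Fact (1 ≤ p k)]
        (_ : sumInv p Finset.univ < 1 / r)
        (i : Fin m) (_ : sumInv p (Finset.univ.erase i) ≤ 1 / r - 1 / q)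
        (n : ℕ) (A : ContinuousMultilinearMap 𝕜 (fun k : Fin m => EllP 𝕜 (p k) n) E),
        (∑ a : Fin n,
            (∑ j ∈ Finset.univ.filter (fun j : Fin m → Fin n => j i = a),
                ‖v (A fun k => PiLp.single (p k) (j k) (1 : 𝕜))‖ ^ q)
              ^ (lambdaExp r p / q))
            ^ (1 / lambdaExp r p)
          ≤ C * ‖A‖ * summingNorm r 1 v := by
  refine ⟨(√2 * (|K| + 1)) ^ m, by positivity, ?_⟩
  intro 𝕜 _ E _ _ _ F _ _ _ q r hr hrq hF v hv p _ hp i hi n A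
  have hr0 : 0 < r := by linarith
  have hq0 : 0 < q := by linarith
  set B := (√2 * (|K| + 1)) ^ m * ‖A‖ * summingNorm r 1 v with hB
  have hB0 : 0 ≤ B := mul_nonneg (by positivity) (summingNorm_nonneg _ _ _)
  set c : (Fin m → Fin n) → ℝ := fun j => ‖v (A fun k => PiLp.single (p k) (j k) (1 : 𝕜))‖
  have hc : ∀ j, 0 ≤ c j := fun j => norm_nonneg _
  set s : Fin m → ℝ := fun k => ((p k)⁻¹).toReal with hs
  have hs0 : ∀ k, 0 ≤ s k := fun k => ENNReal.toReal_nonneg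
  have base : ∀ w : Fin m → Fin n → ℝ, (∀ k l, 0 ≤ w k l) → (∀ k, ∑ l, w k l ≤ 1) → ∀ i,
      ∑ t, (∑ j ∈ Finset.univ.filter (fun j : Fin m → Fin n => j i = t),
        ((∏ k, w k (j k) ^ s k) * c j) ^ q) ^ (r / q) ≤ B ^ r := by
    intro w hw0 hw1 i
    have := sum_weighted_coeff_le hr hrq hF hv A
      (fun k => WithLp.toLp (p k) fun l => ((w k l ^ s k : ℝ) : 𝕜))
      (fun k => norm_toLp_rpow_le_one (hw0 k) (hw1 k)) i
    simpa only [RCLike.norm_ofReal, abs_of_nonneg (Real.rpow_nonneg (hw0 _ _) _)] using this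
  set σ := 1 / r - ∑ k ∈ Finset.univ.erase i, s k with hσ
  have hσq : 1 / q ≤ σ := by
    have : sumInv p (Finset.univ.erase i) = ∑ k ∈ Finset.univ.erase i, s k := rfl
    linarith
  have hlam : lambdaExp r p = (σ - s i)⁻¹ := by
    rw [lambdaExp, sumInv, ← Finset.add_sum_erase _ _ (Finset.mem_univ i), hσ]
    congr 1
    ring
  have hσi : 0 < σ - s i := by
    have : sumInv p Finset.univ = s i + ∑ k ∈ Finset.univ.erase i, s k := by
      rw [sumInv, ← Finset.add_sum_erase _ _ (Finset.mem_univ i)]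
    linarith
  have hσ0 : 0 < σ := (by positivity : 0 < 1 / q).trans_le hσq
  have hS := remove_weights hc hs0 hr0 hrq hB0 base _ hσq
  have hcompl : (Finset.univ.erase i)ᶜ = {i} := by ext; simp
  rw [← hσ, hcompl] at hS
  have hsum0 : ∀ t, 0 ≤ ∑ j ∈ Finset.univ.filter (fun j : Fin m → Fin n => j i = t), c j ^ q :=
    fun t => Finset.sum_nonneg fun j _ => Real.rpow_nonneg (hc j) _
  -- The remaining weight depends on `j i` alone, hence is constant on each inner sum, and duality
  -- needs no comparison with `q`.
  have hfin := sum_rpow_le_of_weighted (β := fun t =>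
    (∑ j ∈ Finset.univ.filter (fun j : Fin m → Fin n => j i = t), c j ^ q) ^ (1 / q))
    (fun t => Real.rpow_nonneg (hsum0 t) _) (s := s i) (inv_pos.2 hσ0) (inv_pos.2 hσi) (by simp) hB0 ?_
  · simp only [← Real.rpow_mul (hsum0 _), one_div_mul_eq_div] at hfin
    rw [hlam]
    have h2 := Real.rpow_le_rpow
      (Finset.sum_nonneg fun t _ => Real.rpow_nonneg (hsum0 t) _) hfin
      (z := 1 / (σ - s i)⁻¹) (by positivity)
    rwa [← Real.rpow_mul hB0, mul_one_div_cancel (inv_pos.2 hσi).ne', Real.rpow_one] at h2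
  intro u hu0 hu1
  refine le_trans (le_of_eq (Finset.sum_congr rfl fun t _ => ?_))
    (hS (fun _ => u) (fun _ => hu0) (fun _ => hu1) i)
  have hu := Real.rpow_nonneg (hu0 t) (s i)
  have e : ∑ j ∈ Finset.univ.filter (fun j : Fin m → Fin n => j i = t),
      ((∏ k ∈ {i}, u (j k) ^ s k) * c j) ^ q
      = (u t ^ s i) ^ q * ∑ j ∈ Finset.univ.filter (fun j : Fin m → Fin n => j i = t), c j ^ q := by
    rw [Finset.mul_sum]
    refine Finset.sum_congr rfl fun j hj => ?_
    rw [Finset.prod_singleton, (Finset.mem_filter.1 hj).2, Real.mul_rpow hu (hc j)]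
  rw [e, Real.mul_rpow hu (Real.rpow_nonneg (hsum0 t) _),
    Real.mul_rpow (Real.rpow_nonneg hu _) (hsum0 t), ← Real.rpow_mul hu,
    ← Real.rpow_mul (hsum0 t), mul_div_cancel₀ _ hq0.ne', one_div_mul_eq_div]
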